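/- A \emph{$k$-matching} of a simple graph $G$ is a set of exactly $k$ edges of $G$, no two of which share an endpoint. In the insert-only streaming model, the edges of a simple graph $G$ on the vertex set $\{0,\dots,n-1\}$ arrive one at a time, each exactly once, in arbitrary order. A randomized one-pass streaming algorithm for the (unweighted) $k$-matching problem knows $n$ and $k$; its memory content is a bit string, which is initialized at random, is updated after each edge as a randomized function (with fresh random coins) of the current memory content and that edge, and from which, at the end of the stream, a randomized answer is computed: either a set of edges or the report "no $k$-matching exists". It has success probability at least $2/3$ if for all $n$, $k$, every graph $G$ on $\{0,\dots,n-1\}$ and every stream for $G$, with probability at least $2/3$ the answer is a $k$-matching of $G$ when $G$ has one, and is the report when $G$ has none. Its space on an instance (a stream together with $k$) is the maximum length in bits of a memory content that occurs with positive probability at the beginning, or after some element, of the stream. Theorem. Any randomized insert-only streaming algorithm for $k$-matching with success probability at least $2/3$ uses $\Omega(k^2)$ bits of space, even on instances whose size is arbitrarily larger than $k$. Precisely: there are absolute constants $c>0$ and $k_0$ such that for every such algorithm, every $k\ge k_0$ and every $N$, there is an instance with parameter $k$, whose graph has more than $N$ vertices and more than $N$ edges, on which the algorithm uses at least $c\,k^2$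 bits of space. -/

import Mathlib

open scoped ENNReal

/-- `S` is an insert-only stream for the simple graph `G` on the vertex set `{0, …, n-1}`: starting
from the empty edge set, it inserts the edges of `G` one by one, in an arbitrary order. -/
def IsInsertStream {n : ℕ} (G : SimpleGraph (Fin n)) (S : List (Sym2 (Fin n))) : Prop :=
  S.Nodup ∧ ∀ e, e ∈ S ↔ e ∈ G.edgeSet

/-- `M` is a `k`-matching of `G`: a set of exactly `k` edges of `G`, no two of which share an
endpoint. -/
def IsKMatching {V : Type*} (G : SimpleGraph V) (k : ℕ) (M : Finset (Sym2 V)) : Prop :=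
  M.card = k ∧ (∀ e ∈ M, e ∈ G.edgeSet) ∧
    ∀ e ∈ M, ∀ f ∈ M, e ≠ f → ∀ v, ¬ (v ∈ e ∧ v ∈ f)

/-- An answer is either a set of edges (`some M`) or the report `none` that there is no
`k`-matching. It is correct for `G` if it is a `k`-matching of `G`, respectively if `G` has no
`k`-matching. -/
def IsCorrectAnswer {V : Type*} (G : SimpleGraph V) (k : ℕ) : Option (Finset (Sym2 V)) → Prop
  | some M => IsKMatching G k M
  | none => ¬ ∃ M, IsKMatching G k M

/-- A randomized one-pass insert-only streaming algorithm for the `k`-matching problem.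
Its memory content is a bit string; it may use fresh random coins in each step, and whatever it
wants to remember (random bits included) has to be kept in the memory. The number `n` of vertices
and the parameter `k` are known to it for free, and no bound is put on its computing power, on the
work space inside a step or on the length of its answer. -/
structure StreamingAlgorithm where
  /-- the distribution of the memory content before the first edge arrives -/
  init (n k : ℕ) : PMF (List Bool)
  /-- the distribution of the new memory content after an edge is inserted -/
  step (n k : ℕ) (e : Sym2 (Fin n)) (mem : List Bool) : PMF (List Bool)
  /-- the distribution of the answer, given the memory content at the end of the stream -/
  answer (n k : ℕ) (mem : List Bool) : PMF (Option (Finset (Sym2 (Fin n))))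

namespace StreamingAlgorithm

/-- The distribution of the memory content after the elements of `S` were read in order. -/
noncomputable def memory (A : StreamingAlgorithm) (n k : ℕ) (S : List (Sym2 (Fin n))) :
    PMF (List Bool) :=
  S.foldl (fun μ e => μ.bind (A.step n k e)) (A.init n k)

/-- The distribution of the answer on the instance `(S, k)`. -/
noncomputable def output (A : StreamingAlgorithm) (n k : ℕ) (S : List (Sym2 (Fin n))) :
    PMF (Option (Finset (Sym2 (Fin n)))) :=
  (A.memory n k S).bind (A.answer n k)

/-- The space, in bits, that the algorithm uses on the instance `(S, k)`: the largest length of a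
memory content that occurs with positive probability after some prefix of `S`. -/
noncomputable def space (A : StreamingAlgorithm) (n k : ℕ) (S : List (Sym2 (Fin n))) : ℕ∞ :=
  ⨆ (P : List (Sym2 (Fin n))) (_ : P <+: S) (mem ∈ (A.memory n k P).support),
    (mem.length : ℕ∞)

/-- On every instance, the answer is correct with probability at least `p`. -/
def HasSuccessProb (A : StreamingAlgorithm) (p : ℝ≥0∞) : Prop :=
  ∀ (n k : ℕ) (G : SimpleGraph (Fin n)) (S : List (Sym2 (Fin n))), IsInsertStream G S →
    p ≤ (A.output n k S).toOuterMeasure {a | IsCorrectAnswer G k a}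

end StreamingAlgorithm

/-! ### The index problem -/

/-! Reduction from the index problem. A bit vector over the pairs of `k + 1` core vertices is
streamed as a core graph. To query a pair `e`, pendant edges are then attached to each of the `k -
1` core vertices outside `e`. If `e` is present, it forms a `k`-matching with one pendant edge per
outside vertex (`exists_isKMatching_of_mem`). If not, the outside vertices cover every edge, so no
`k`-matching exists (`not_exists_isKMatching_of_notMem`). Many leaves per vertex make the instance
large without affecting this.

The memory between the two phases is thus a message from which each bit can be recovered with
probability 2/3, and `card_le_of_index_protocol` forces its length to be linear in the number of
pairs. That bound is a count: weight a message by 2 to its expected number of correct guesses. Over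
all vectors, one message has total weight at most `3 ^ D`, while each vector needs a message of
weight at least `2 ^ (2D/3)`, and `2 ^ (5/3) > 3`. -/

lemma two_rpow_add_two_rpow_one_sub_le {q : ℝ} (h0 : 0 ≤ q) (h1 : q ≤ 1) :
    (2 : ℝ) ^ q + (2 : ℝ) ^ (1 - q) ≤ 3 := by
  -- By convexity, `2 ^ p` lies below its chord on `[0, 1]`.
  have key : ∀ p : ℝ, 0 ≤ p → p ≤ 1 → (2 : ℝ) ^ p ≤ 1 + p := fun p hp hp' => by
    have := rpow_one_add_le_one_add_mul_self (s := (1 : ℝ)) (by norm_num) hp hp'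
    norm_num at this
    exact this
  linarith [key q h0 h1, key (1 - q) (by linarith) (by linarith)]

/-- Few fractional guesses cannot agree with every bit vector in two thirds of the positions. -/
lemma two_pow_mul_two_rpow_le_card_mul {E M : Type*} [Fintype E] (T : Finset M)
    (q : M → E → ℝ) (h0 : ∀ m e, 0 ≤ q m e) (h1 : ∀ m e, q m e ≤ 1)
    (h : ∀ x : E → Bool, ∃ m ∈ T,
      2 / 3 * (Fintype.card E : ℝ) ≤ ∑ e, if x e then q m e else 1 - q m e) :
    (2 : ℝ) ^ Fintype.card E * (2 : ℝ) ^ (2 / 3 * (Fintype.card E : ℝ)) ≤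
      T.card * 3 ^ Fintype.card E := by
  classical
  calc (2 : ℝ) ^ Fintype.card E * (2 : ℝ) ^ (2 / 3 * (Fintype.card E : ℝ))
      = ∑ _x : E → Bool, (2 : ℝ) ^ (2 / 3 * (Fintype.card E : ℝ)) := by simp
    _ ≤ ∑ x : E → Bool, ∑ m ∈ T, (2 : ℝ) ^ (∑ e, if x e then q m e else 1 - q m e) := by
        refine Finset.sum_le_sum fun x _ => ?_
        obtain ⟨m, hm, hx⟩ := h x
        exact (Real.rpow_le_rpow_of_exponent_le one_le_two hx).trans
          (Finset.single_le_sum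
            (f := fun m => (2 : ℝ) ^ (∑ e, if x e then q m e else 1 - q m e))
            (fun _ _ => by positivity) hm)
    -- For fixed `m` the weight is a product over positions, so its sum over all bit vectors
    -- factorizes.
    _ = ∑ m ∈ T, ∏ e, ((2 : ℝ) ^ q m e + (2 : ℝ) ^ (1 - q m e)) := by
        rw [Finset.sum_comm]
        refine Finset.sum_congr rfl fun m _ => ?_
        have := Finset.prod_univ_sum (fun _ : E => (Finset.univ : Finset Bool))
          (fun e b => (2 : ℝ) ^ (if b then q m e else 1 - q m e))
        simp only [Fintype.piFinset_univ, Fintype.sum_bool, if_true, Bool.false_eq_true,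
          if_false] at this
        rw [this]
        refine Finset.sum_congr rfl fun x _ => ?_
        rw [← Real.rpow_sum_of_pos two_pos]
    _ ≤ ∑ _m ∈ T, (3 : ℝ) ^ Fintype.card E := by
        refine Finset.sum_le_sum fun m _ => ?_
        refine (Finset.prod_le_prod (fun e _ => by positivity) fun e _ =>
          two_rpow_add_two_rpow_one_sub_le (h0 m e) (h1 m e)).trans_eq ?_
        simp
    _ = T.card * 3 ^ Fintype.card E := by simp

/-- The 15th power clears the fractional exponent, and `2 * 3 ^ 15 ≤ 2 ^ 25` leaves a spare factor
`2 ^ D`. -/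
lemma le_fifteen_mul_of_two_pow_mul_le {D s : ℕ}
    (h : (2 : ℝ) ^ D * (2 : ℝ) ^ (2 / 3 * (D : ℝ)) ≤ 2 ^ s * 3 ^ D) : D ≤ 15 * s := by
  have h3 : ((2 : ℝ) ^ (2 / 3 * (D : ℝ))) ^ 15 = (2 ^ 10) ^ D := by
    rw [← Real.rpow_natCast, ← Real.rpow_mul two_pos.le, ← pow_mul, ← Real.rpow_natCast]
    congr 1
    push_cast
    ring
  have h4 := pow_le_pow_left₀ (by positivity) h 15
  rw [mul_pow, mul_pow, h3, pow_right_comm 2 D 15, pow_right_comm 3 D 15, ← mul_pow,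
    ← pow_mul] at h4
  have h5 : ((2 : ℝ) * 3 ^ 15) ^ D ≤ (2 ^ 15 * 2 ^ 10) ^ D :=
    pow_le_pow_left₀ (by positivity) (by norm_num) D
  rw [mul_pow] at h5
  have h6 : (2 : ℝ) ^ D ≤ 2 ^ (s * 15) :=
    le_of_mul_le_mul_right (h5.trans h4) (by positivity)
  rw [mul_comm 15 s]
  exact (pow_le_pow_iff_right₀ one_lt_two).1 h6

lemma PMF.exists_mem_support_le_of_le_tsum {M : Type*} (μ : PMF M) (T : Finset M)
    (hT : ∀ m ∈ μ.support, m ∈ T) (f : M → ℝ≥0∞) {b : ℝ≥0∞}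
    (hb : b ≤ ∑' m, μ m * f m) : ∃ m ∈ T, b ≤ f m := by
  classical
  by_contra! hlt
  -- Only points of positive mass keep the inequality strict after weighting.
  set T' := T.filter fun m => μ m ≠ 0
  have hsum : ∀ g : M → ℝ≥0∞, ∑' m, μ m * g m = ∑ m ∈ T', μ m * g m := fun g => by
    refine tsum_eq_sum fun m hm => ?_
    by_contra h
    have h0 : μ m ≠ 0 := left_ne_zero_of_mul h
    exact hm (Finset.mem_filter.2 ⟨hT m ((μ.mem_support_iff m).2 h0), h0⟩)
  have h1 : ∑ m ∈ T', μ m = 1 := by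
    rw [← μ.tsum_coe]
    simpa using (hsum fun _ => 1).symm
  have hne : T'.Nonempty := by
    obtain ⟨m, hm⟩ := μ.support_nonempty
    exact ⟨m, Finset.mem_filter.2 ⟨hT m hm, (μ.mem_support_iff m).1 hm⟩⟩
  have hlt' : ∑ m ∈ T', μ m * f m < ∑ m ∈ T', μ m * b :=
    ENNReal.sum_lt_sum_of_nonempty hne fun m hm =>
      (ENNReal.mul_lt_mul_iff_right (Finset.mem_filter.1 hm).2 (μ.apply_ne_top m)).2
        (hlt m (Finset.mem_filter.1 hm).1)
  rw [← Finset.sum_mul, h1, one_mul, ← hsum] at hlt'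
  exact absurd hb hlt'.not_ge

/-- The one-way randomized communication complexity of the index problem is linear: `μ x` is the
distribution of the message for the bit vector `x`, and `r e` is the randomized decoder for the
bit at position `e`, which answers `true` on `s e`. -/
lemma card_le_of_index_protocol {E M R : Type*} [Fintype E] (T : Finset M)
    (μ : (E → Bool) → PMF M) (hT : ∀ x, ∀ m ∈ (μ x).support, m ∈ T)
    (r : E → M → PMF R) (Y : Set R)
    (h : ∀ x e, 2 / 3 ≤ ((μ x).bind (r e)).toOuterMeasure (if x e then Y else Yᶜ))
    {s : ℕ} (hs : T.card ≤ 2 ^ s) : Fintype.card E ≤ 15 * s := by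
  have hadd : ∀ m e, (r e m).toOuterMeasure Y + (r e m).toOuterMeasure Yᶜ = 1 := fun m e => by
    rw [PMF.toOuterMeasure_apply, PMF.toOuterMeasure_apply, ← ENNReal.tsum_add,
      ← (r e m).tsum_coe]
    refine tsum_congr fun a => ?_
    exact congrFun (Set.indicator_self_add_compl Y (r e m)) a
  have hle : ∀ m e, (r e m).toOuterMeasure Y ≤ 1 := fun m e => (hadd m e) ▸ le_self_add
  have hne : ∀ m e, (r e m).toOuterMeasure Y ≠ ∞ := fun m e =>
    ((hle m e).trans_lt ENNReal.one_lt_top).ne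
  refine le_fifteen_mul_of_two_pow_mul_le (le_trans (two_pow_mul_two_rpow_le_card_mul T
    (fun m e => ((r e m).toOuterMeasure Y).toReal) (fun _ _ => ENNReal.toReal_nonneg)
    (fun m e => ENNReal.toReal_mono ENNReal.one_ne_top (hle m e)) fun x => ?_)
    (mul_le_mul_of_nonneg_right (by exact_mod_cast hs) (by positivity)))
  -- Averaged over messages, the expected number of correctly decoded positions is at least `2/3` of
  -- all, so some single message does as well.
  obtain ⟨m, hm, hb⟩ := (μ x).exists_mem_support_le_of_le_tsum T (hT x)
    (fun m => ∑ e, (r e m).toOuterMeasure (if x e then Y else Yᶜ))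
    (b := (2 / 3) * (Fintype.card E : ℝ≥0∞)) (by
      simp_rw [Finset.mul_sum]
      rw [Summable.tsum_finsetSum fun _ _ => ENNReal.summable]
      calc (2 / 3) * (Fintype.card E : ℝ≥0∞) = ∑ _e : E, (2 / 3 : ℝ≥0∞) := by
            simp [mul_comm]
        _ ≤ _ := Finset.sum_le_sum fun e _ => by
            rw [← PMF.toOuterMeasure_bind_apply]
            exact h x e)
  refine ⟨m, hm, ?_⟩
  have heq : ∀ e, ((r e m).toOuterMeasure (if x e then Y else Yᶜ)) =
      ENNReal.ofReal (if x e then ((r e m).toOuterMeasure Y).toReal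
        else 1 - ((r e m).toOuterMeasure Y).toReal) := fun e => by
    split_ifs
    · rw [ENNReal.ofReal_toReal (hne m e)]
    · rw [ENNReal.ofReal_sub _ ENNReal.toReal_nonneg, ENNReal.ofReal_toReal (hne m e),
        ENNReal.ofReal_one, ← hadd m e]
      exact (ENNReal.add_sub_cancel_left (hne m e)).symm
  have hnn : ∀ e, 0 ≤ (if x e then ((r e m).toOuterMeasure Y).toReal
        else 1 - ((r e m).toOuterMeasure Y).toReal) := fun e => by
    split_ifs
    · exact ENNReal.toReal_nonneg
    · exact sub_nonneg.2 (ENNReal.toReal_mono ENNReal.one_ne_top (hle m e))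
  simp_rw [heq] at hb
  rw [← ENNReal.ofReal_sum_of_nonneg fun e _ => hnn e] at hb
  have h23 : (2 / 3 : ℝ≥0∞) * (Fintype.card E : ℝ≥0∞) =
      ENNReal.ofReal (2 / 3 * (Fintype.card E : ℝ)) := by
    rw [ENNReal.ofReal_mul (by norm_num), ENNReal.ofReal_natCast,
      ENNReal.ofReal_div_of_pos (by norm_num)]
    simp
  rw [h23] at hb
  exact (ENNReal.ofReal_le_ofReal_iff (Finset.sum_nonneg fun e _ => hnn e)).1 hb

/-! ### Memory contents -/

lemma exists_finset_lists_length_lt (s : ℕ) :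
    ∃ T : Finset (List Bool), (∀ l : List Bool, l.length < s → l ∈ T) ∧ T.card ≤ 2 ^ s := by
  classical
  refine ⟨(Finset.univ : Finset (Σ i : Fin s, Fin i → Bool)).image fun p => List.ofFn p.2,
    fun l hl => ?_, Finset.card_image_le.trans ?_⟩
  · exact Finset.mem_image.2 ⟨⟨⟨l.length, hl⟩, l.get⟩, Finset.mem_univ _, List.ofFn_get l⟩
  · rw [Finset.card_univ, Fintype.card_sigma]
    simp only [Fintype.card_pi, Fintype.card_bool, Finset.prod_const, Finset.card_univ,
      Fintype.card_fin]
    rw [Fin.sum_univ_eq_sum_range (fun i => 2 ^ i), Nat.geomSum_eq le_rfl]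
    simp

/-- Markov property: a run depends on the past only through the current memory, which can therefore
serve as the message. -/
lemma PMF.foldl_bind {α β : Type*} (f : β → α → PMF α) (S : List β) (μ : PMF α) :
    S.foldl (fun ν e => ν.bind (f e)) μ =
      μ.bind fun m => S.foldl (fun ν e => ν.bind (f e)) (PMF.pure m) := by
  induction S generalizing μ with
  | nil => simp
  | cons e S ih =>
    simp only [List.foldl_cons, PMF.pure_bind]
    rw [ih, PMF.bind_bind]
    congr 1
    funext m
    exact (ih (f e m)).symm

namespace StreamingAlgorithm

/-- The distribution of the answer when the algorithm reads `S` from memory content `m` on. -/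
noncomputable def outputFrom (A : StreamingAlgorithm) (n k : ℕ) (S : List (Sym2 (Fin n)))
    (m : List Bool) : PMF (Option (Finset (Sym2 (Fin n)))) :=
  (S.foldl (fun μ e => μ.bind (A.step n k e)) (PMF.pure m)).bind (A.answer n k)

lemma output_append (A : StreamingAlgorithm) (n k : ℕ) (S S' : List (Sym2 (Fin n))) :
    A.output n k (S ++ S') = (A.memory n k S).bind (A.outputFrom n k S') := by
  rw [output, memory, List.foldl_append, PMF.foldl_bind, PMF.bind_bind]
  rfl

lemma length_le_space (A : StreamingAlgorithm) {n k : ℕ} {P S : List (Sym2 (Fin n))}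
    (hP : P <+: S) {m : List Bool} (hm : m ∈ (A.memory n k P).support) :
    (m.length : ℕ∞) ≤ A.space n k S :=
  le_iSup₂_of_le P hP (le_iSup₂_of_le m hm le_rfl)

end StreamingAlgorithm

/-! ### The hard instances -/

section HardInstance

variable {α V : Type*} {N : ℕ} (φ : α × Fin (N + 2) → V)

/-- The copies in `V` of the edges in `x`; the vertex `a` has the copy `φ (a, 0)`. -/
noncomputable def coreEdges [DecidableEq V] (x : Finset (Sym2 α)) : Finset (Sym2 V) :=
  x.image (Sym2.map fun a => φ (a, 0))

/-- Pendant edges, `N + 1` of them at the copy of each vertex outside `e`. -/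
noncomputable def pendantEdges [DecidableEq V] [DecidableEq α] [Fintype α] (e : Sym2 α) :
    Finset (Sym2 V) :=
  ((Finset.univ.filter fun a => a ∉ e) ×ˢ (Finset.univ : Finset (Fin (N + 1)))).image
    fun p => s(φ (p.1, 0), φ (p.1, p.2.succ))

variable [DecidableEq V] {φ}

lemma coreEdges_not_isDiag (hφ : Function.Injective φ) {x : Finset (Sym2 α)}
    (hx : ∀ e ∈ x, ¬ e.IsDiag) {f : Sym2 V} (hf : f ∈ coreEdges φ x) : ¬ f.IsDiag := by
  obtain ⟨e, he, rfl⟩ := Finset.mem_image.1 hf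
  have := hx e he
  induction e with
  | _ a b => simpa [hφ.eq_iff] using this

variable [DecidableEq α] [Fintype α]

lemma pendantEdges_not_isDiag (hφ : Function.Injective φ) {e : Sym2 α} {f : Sym2 V}
    (hf : f ∈ pendantEdges φ e) : ¬ f.IsDiag := by
  obtain ⟨p, -, rfl⟩ := Finset.mem_image.1 hf
  simpa [hφ.eq_iff] using (Fin.succ_ne_zero p.2).symm

lemma disjoint_coreEdges_pendantEdges (hφ : Function.Injective φ) (x : Finset (Sym2 α))
    (e : Sym2 α) : Disjoint (coreEdges φ x) (pendantEdges φ e) := by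
  rw [Finset.disjoint_left]
  intro f hf hf'
  obtain ⟨g, -, rfl⟩ := Finset.mem_image.1 hf
  obtain ⟨p, -, hp⟩ := Finset.mem_image.1 hf'
  have : φ (p.1, p.2.succ) ∈ Sym2.map (fun a => φ (a, 0)) g := hp ▸ Sym2.mem_mk_right _ _
  obtain ⟨a, -, ha⟩ := Sym2.mem_map.1 this
  exact Fin.succ_ne_zero p.2 (congrArg Prod.snd (hφ ha)).symm

lemma card_filter_notMem_sym2 {e : Sym2 α} (he : ¬ e.IsDiag) :
    (Finset.univ.filter fun a => a ∉ e).card + 2 = Fintype.card α := by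
  induction e with
  | _ a b =>
    have hab : a ≠ b := by simpa using he
    have h : (Finset.univ.filter fun c => c ∉ s(a, b)) = ({a, b} : Finset α)ᶜ := by
      ext c
      simp
    rw [h, ← Finset.card_pair hab, Finset.card_compl_add_card]

lemma card_pendantEdges (hφ : Function.Injective φ) {e : Sym2 α} (he : ¬ e.IsDiag) :
    (pendantEdges φ e).card = (Fintype.card α - 2) * (N + 1) := by
  rw [pendantEdges, Finset.card_image_of_injective, Finset.card_product, Finset.card_univ,
    Fintype.card_fin, ← card_filter_notMem_sym2 he, Nat.add_sub_cancel]
  rintro ⟨a, i⟩ ⟨b, j⟩ h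
  simp only [Sym2.eq_iff, hφ.eq_iff, Prod.mk.injEq, Fin.succ_inj] at h
  rcases h with h | h
  · exact Prod.ext h.1.1 h.2.2
  · exact absurd h.1.2.symm (Fin.succ_ne_zero j)

variable {G : SimpleGraph V} {x : Finset (Sym2 α)} {e : Sym2 α}

lemma exists_isKMatching_of_mem (hφ : Function.Injective φ)
    (hG : ∀ f ∈ coreEdges φ x ∪ pendantEdges φ e, f ∈ G.edgeSet)
    (hd : ¬ e.IsDiag) (he : e ∈ x) {k : ℕ} (hk : Fintype.card α = k + 1) :
    ∃ M, IsKMatching G k M := by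
  have hinj : Function.Injective fun a => s(φ (a, 0), φ (a, (0 : Fin (N + 1)).succ)) := by
    intro a b h
    have ha : φ (a, 0) ∈ s(φ (b, 0), φ (b, (0 : Fin (N + 1)).succ)) := by
      have h' : s(φ (a, 0), φ (a, (0 : Fin (N + 1)).succ)) =
        s(φ (b, 0), φ (b, (0 : Fin (N + 1)).succ)) := h
      exact h' ▸ Sym2.mem_mk_left _ _
    rcases Sym2.mem_iff.1 ha with h | h <;> exact congrArg Prod.fst (hφ h)
  have hcore : ∀ v a, v ∈ Sym2.map (fun a => φ (a, 0)) e → a ∉ e →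
      v ∉ s(φ (a, 0), φ (a, (0 : Fin (N + 1)).succ)) := by
    intro v a hv ha hv'
    obtain ⟨b, hb, rfl⟩ := Sym2.mem_map.1 hv
    rcases Sym2.mem_iff.1 hv' with h | h <;>
    · have hba : b = a := congrArg Prod.fst (hφ h)
      exact ha (hba ▸ hb)
  have hpend : ∀ v a b, a ≠ b → v ∈ s(φ (a, 0), φ (a, (0 : Fin (N + 1)).succ)) →
      v ∉ s(φ (b, 0), φ (b, (0 : Fin (N + 1)).succ)) := by
    intro v a b hab hv hv'
    rcases Sym2.mem_iff.1 hv with rfl | rfl <;> rcases Sym2.mem_iff.1 hv' with h | h <;>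
      exact hab (congrArg Prod.fst (hφ h))
  refine ⟨insert (Sym2.map (fun a => φ (a, 0)) e) ((Finset.univ.filter fun a => a ∉ e).image
    fun a => s(φ (a, 0), φ (a, (0 : Fin (N + 1)).succ))), ?_, ?_, ?_⟩
  · rw [Finset.card_insert_of_notMem, Finset.card_image_of_injective _ hinj]
    · have := card_filter_notMem_sym2 hd
      omega
    · intro h
      obtain ⟨a, ha, h⟩ := Finset.mem_image.1 h
      refine hcore (φ (a, 0)) a ?_ (Finset.mem_filter.1 ha).2 (Sym2.mem_mk_left _ _)
      rw [← h]
      exact Sym2.mem_mk_left _ _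
  · intro f hf
    refine hG f (Finset.mem_union.2 ?_)
    rcases Finset.mem_insert.1 hf with rfl | hf
    · exact Or.inl (Finset.mem_image_of_mem _ he)
    · obtain ⟨a, ha, rfl⟩ := Finset.mem_image.1 hf
      exact Or.inr (Finset.mem_image.2 ⟨(a, 0), Finset.mem_product.2 ⟨ha, Finset.mem_univ _⟩, rfl⟩)
  · intro f hf g hg hfg v hv
    rcases Finset.mem_insert.1 hf with rfl | hf <;> rcases Finset.mem_insert.1 hg with rfl | hg
    · exact hfg rfl
    · obtain ⟨a, ha, rfl⟩ := Finset.mem_image.1 hg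
      exact hcore v a hv.1 (Finset.mem_filter.1 ha).2 hv.2
    · obtain ⟨a, ha, rfl⟩ := Finset.mem_image.1 hf
      exact hcore v a hv.2 (Finset.mem_filter.1 ha).2 hv.1
    · obtain ⟨a, ha, rfl⟩ := Finset.mem_image.1 hf
      obtain ⟨b, hb, rfl⟩ := Finset.mem_image.1 hg
      exact hpend v a b (fun h => hfg (h ▸ rfl)) hv.1 hv.2

/-- This makes the vertices outside `e` cover every core edge other than `e`. -/
lemma exists_notMem_of_ne {f : Sym2 α} (hd : ¬ f.IsDiag) (hf : f ≠ e) : ∃ a ∈ f, a ∉ e := by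
  induction f with
  | _ a b =>
    by_contra! h
    exact hf ((Sym2.mem_and_mem_iff (by simpa using hd)).1
      ⟨h a (Sym2.mem_mk_left _ _), h b (Sym2.mem_mk_right _ _)⟩).symm

lemma not_exists_isKMatching_of_notMem
    (hG : ∀ f ∈ G.edgeSet, f ∈ coreEdges φ x ∪ pendantEdges φ e)
    (hx : ∀ f ∈ x, ¬ f.IsDiag) (hd : ¬ e.IsDiag) (he : e ∉ x) {k : ℕ}
    (hk : Fintype.card α = k + 1) : ¬ ∃ M, IsKMatching G k M := by
  rintro ⟨M, hM, hMG, hdisj⟩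
  have hcover : ∀ f ∈ M, ∃ a, a ∉ e ∧ φ (a, 0) ∈ f := by
    intro f hf
    rcases Finset.mem_union.1 (hG f (hMG f hf)) with h | h
    · obtain ⟨g, hg, rfl⟩ := Finset.mem_image.1 h
      obtain ⟨a, hag, hae⟩ := exists_notMem_of_ne (e := e) (hx g hg) fun h => he (h ▸ hg)
      exact ⟨a, hae, Sym2.mem_map.2 ⟨a, hag, rfl⟩⟩
    · obtain ⟨p, hp, rfl⟩ := Finset.mem_image.1 h
      exact ⟨p.1, (Finset.mem_filter.1 (Finset.mem_product.1 hp).1).2, Sym2.mem_mk_left _ _⟩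
  have hcard : M.card ≤ (Finset.univ.filter fun a => a ∉ e).card := by
    -- Disjoint edges use distinct cover vertices, so a matching is no larger than the cover.
    refine Finset.card_le_card_of_forall_subsingleton (fun f a => φ (a, 0) ∈ f) ?_ ?_
    · intro f hf
      obtain ⟨a, ha, haf⟩ := hcover f hf
      exact ⟨a, by simpa using ha, haf⟩
    · rintro a - f ⟨hf, haf⟩ g ⟨hg, hag⟩
      by_contra hfg
      exact hdisj f hf g hg hfg _ ⟨haf, hag⟩
  have := card_filter_notMem_sym2 hd
  omega

end HardInstance

/-- The positions of the index problem: the pairs of distinct vertices among `k + 1`. -/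
abbrev VertexPair (k : ℕ) : Type := {e : Sym2 (Fin (k + 1)) // ¬ e.IsDiag}

/-- The pairs marked by the bit vector `x`. -/
def markedPairs {k : ℕ} (x : VertexPair k → Bool) : Finset (Sym2 (Fin (k + 1))) :=
  (Finset.univ.filter fun e => x e = true).map (Function.Embedding.subtype _)

lemma mem_markedPairs {k : ℕ} {x : VertexPair k → Bool} (e : VertexPair k) :
    e.1 ∈ markedPairs x ↔ x e = true := by
  simp [markedPairs, e.2]

lemma markedPairs_not_isDiag {k : ℕ} {x : VertexPair k → Bool} {e : Sym2 (Fin (k + 1))}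
    (he : e ∈ markedPairs x) : ¬ e.IsDiag := by
  obtain ⟨f, -, rfl⟩ := Finset.mem_map.1 he
  exact f.2

lemma card_le_of_space_lt (A : StreamingAlgorithm) (hA : A.HasSuccessProb (2 / 3)) {k s : ℕ}
    (hk : 2 ≤ k) (N : ℕ)
    (hs : ∀ (n : ℕ) (G : SimpleGraph (Fin n)) (S : List (Sym2 (Fin n))),
      IsInsertStream G S → N < n → N < S.length → A.space n k S < s) :
    (k + 1).choose 2 ≤ 15 * s := by
  set n := (k + 1) * (N + 2) with hn
  let φ : Fin (k + 1) × Fin (N + 2) → Fin n := finProdFinEquiv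
  have hφ : Function.Injective φ := finProdFinEquiv.injective
  let P (x : VertexPair k → Bool) : List (Sym2 (Fin n)) := (coreEdges φ (markedPairs x)).toList
  let Q (e : VertexPair k) : List (Sym2 (Fin n)) := (pendantEdges φ e.1).toList
  let G (x : VertexPair k → Bool) (e : VertexPair k) : SimpleGraph (Fin n) :=
    SimpleGraph.fromEdgeSet ↑(coreEdges φ (markedPairs x) ∪ pendantEdges φ e.1)
  have hG : ∀ x e f, f ∈ (G x e).edgeSet ↔
      f ∈ coreEdges φ (markedPairs x) ∪ pendantEdges φ e.1 := by
    intro x e f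
    simp only [G, SimpleGraph.edgeSet_fromEdgeSet, Set.mem_sdiff, Finset.mem_coe]
    refine and_iff_left_of_imp fun hf => ?_
    rcases Finset.mem_union.1 hf with hf | hf
    · exact coreEdges_not_isDiag hφ (fun _ => markedPairs_not_isDiag) hf
    · exact pendantEdges_not_isDiag hφ hf
  have hS : ∀ x e, IsInsertStream (G x e) (P x ++ Q e) := by
    refine fun x e => ⟨List.nodup_append'.2 ⟨Finset.nodup_toList _, Finset.nodup_toList _, ?_⟩,
      fun f => ?_⟩
    · intro f hf hf'
      exact Finset.disjoint_left.1 (disjoint_coreEdges_pendantEdges hφ _ _)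
        (Finset.mem_toList.1 hf) (Finset.mem_toList.1 hf')
    · rw [hG, List.mem_append, Finset.mem_toList, Finset.mem_toList, Finset.mem_union]
  have hNn : N < n := by
    rw [hn]
    nlinarith
  have hlen : ∀ x e, N < (P x ++ Q e).length := by
    intro x e
    rw [List.length_append, Finset.length_toList, Finset.length_toList,
      card_pendantEdges hφ e.2, Fintype.card_fin]
    -- Since `2 ≤ k`, some core vertex lies outside `e`; its pendant edges alone exceed `N`.
    have : 1 * (N + 1) ≤ (k + 1 - 2) * (N + 1) := Nat.mul_le_mul_right _ (by omega)
    omega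
  obtain ⟨T, hT, hTcard⟩ := exists_finset_lists_length_lt s
  -- The space bound concerns complete long streams; an arbitrary query completes `P x` to one.
  have e₀ : VertexPair k := ⟨s(0, Fin.last k), by
    rw [Sym2.mk_isDiag_iff, Fin.ext_iff, Fin.val_zero, Fin.val_last]
    omega⟩
  have hcard := card_le_of_index_protocol T (fun x => A.memory n k (P x))
    (fun x m hm => hT m (by
      exact_mod_cast (A.length_le_space (List.prefix_append _ (Q e₀)) hm).trans_lt
        (hs n _ _ (hS x e₀) hNn (hlen x e₀))))
    -- The decoder only uses whether an edge set is reported.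
    (fun e => A.outputFrom n k (Q e)) {a | a.isSome} (fun x e => by
      rw [← A.output_append]
      refine (hA n k (G x e) _ (hS x e)).trans (MeasureTheory.measure_mono ?_)
      intro a ha
      by_cases hxe : x e = true
      · have hM := exists_isKMatching_of_mem hφ (fun f => (hG x e f).2) e.2
          ((mem_markedPairs e).2 hxe) (Fintype.card_fin (k + 1))
        rw [if_pos hxe]
        cases a with
        | none => exact absurd hM ha
        | some M => rfl
      · have hM := not_exists_isKMatching_of_notMem (fun f => (hG x e f).1)
          (fun _ => markedPairs_not_isDiag) e.2 (fun h => hxe ((mem_markedPairs e).1 h))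
          (Fintype.card_fin (k + 1))
        rw [if_neg hxe]
        cases a with
        | none => simp
        | some M => exact absurd ⟨M, ha⟩ hM) hTcard
  rwa [Sym2.card_subtype_not_diag, Fintype.card_fin] at hcard

theorem theoremA1 :
    ∃ c : ℝ, 0 < c ∧ ∃ k₀ : ℕ, ∀ A : StreamingAlgorithm, A.HasSuccessProb (2 / 3) →
      ∀ k : ℕ, k₀ ≤ k → ∀ N : ℕ,
        ∃ (n : ℕ) (G : SimpleGraph (Fin n)) (S : List (Sym2 (Fin n))),
          IsInsertStream G S ∧ N < n ∧ N < S.length ∧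
            ENNReal.ofReal (c * (k : ℝ) ^ 2) ≤ ((A.space n k S : ℕ∞) : ℝ≥0∞) := by
  -- Less space would give `k(k+1)/2 ≤ 15⌈k²/60⌉ < k²/4 + 15`, which is false for `k ≥ 10`.
  refine ⟨1 / 60, by norm_num, 10, fun A hA k hk N => ?_⟩
  by_contra! hcon
  have hle := card_le_of_space_lt A hA (k := k) (s := ⌈1 / 60 * (k : ℝ) ^ 2⌉₊) (by omega) N
    fun n G S hS hn hl => by
      have h := (hcon n G S hS hn hl).trans_le (ENNReal.ofReal_le_ofReal (Nat.le_ceil _))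
      rw [ENNReal.ofReal_natCast] at h
      exact_mod_cast h
  have hceil := Nat.ceil_lt_add_one (a := 1 / 60 * (k : ℝ) ^ 2) (by positivity)
  have hle' : (((k + 1).choose 2 : ℕ) : ℝ) ≤ 15 * (⌈1 / 60 * (k : ℝ) ^ 2⌉₊ : ℝ) := by
    exact_mod_cast hle
  rw [Nat.cast_choose_two] at hle'
  have hk' : (10 : ℝ) ≤ k := by exact_mod_cast hk
  push_cast at hle'
  nlinarith
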